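/- For an integer $n\ge 4$ and elements $a,b,c,k\in\mathbb Z_n$, all different from $0$, with $a,b,c$ pairwise distinct and with $k\neq n/2$ when $n$ is even, the Nest graph $\mathrm{Nest}(n;a,b,c;k)$ is the simple graph with the $2n$ distinct vertices $u_i,v_i$ $(i\in\mathbb Z_n)$ and the edges $$\{u_i,u_{i+1}\},\quad \{v_i,v_{i+k}\},\quad \{u_i,v_i\},\ \{u_i,v_{i+a}\},\ \{u_i,v_{i+b}\},\ \{u_i,v_{i+c}\}\qquad (i\in\mathbb Z_n),$$ where subscripts are computed in $\mathbb Z_n$. A graph is edge-transitive if its automorphism group acts transitively on its set of edges. Let $n>8$, let $\Gamma=\mathrm{Nest}(n;a,b,c;k)$ be an edge-transitive Nest graph, and suppose that some non-identity automorphism of $\Gamma$ fixes all the vertices $u_i$, $i\in\mathbb Z_n$. Then there is an odd number $m$ such that $2,\,m,\,2+m,\,1\in\mathbb Z_{2m}$ are admissible parameters of a Nest graph (that is, they satisfy the conditions above for $2m$ in place of $n$) and $\Gamma\cong\mathrm{Nest}(2m;2,m,2+m;1)$. -/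

import Mathlib

/-- The conditions on the parameters of a Nest graph: `n ≥ 4`, the elements `a, b, c, k` of
`ℤ/nℤ` are non-zero, `a, b, c` are pairwise distinct, and `k ≠ n/2` when `n` is even. -/
structure IsNestParam (n : ℕ) (a b c k : ZMod n) : Prop where
  four_le : 4 ≤ n
  a_ne_zero : a ≠ 0
  b_ne_zero : b ≠ 0
  c_ne_zero : c ≠ 0
  k_ne_zero : k ≠ 0
  a_ne_b : a ≠ b
  a_ne_c : a ≠ c
  b_ne_c : b ≠ c
  k_ne_half : Even n → k ≠ ((n / 2 : ℕ) : ZMod n)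

/-- The oriented edges of a Nest graph. The vertex `u_i` is `Sum.inl i` and the vertex `v_i` is
`Sum.inr i`. -/
def nestRel (n : ℕ) (a b c k : ZMod n) : ZMod n ⊕ ZMod n → ZMod n ⊕ ZMod n → Prop
  | Sum.inl i, Sum.inl j => j = i + 1
  | Sum.inl i, Sum.inr j => j = i ∨ j = i + a ∨ j = i + b ∨ j = i + c
  | Sum.inr i, Sum.inr j => j = i + k
  | Sum.inr _, Sum.inl _ => False

/-- The Nest graph `Nest(n; a, b, c; k)`: its edges are the rim edges `{u_i, u_{i+1}}`, the hub
edges `{v_i, v_{i+k}}`, and the spoke edges `{u_i, v_i}`, `{u_i, v_{i+a}}`, `{u_i, v_{i+b}}`,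
`{u_i, v_{i+c}}`, for `i` in `ℤ/nℤ`. -/
def nestGraph (n : ℕ) (a b c k : ZMod n) : SimpleGraph (ZMod n ⊕ ZMod n) :=
  SimpleGraph.fromRel (nestRel n a b c k)

/-- A graph is edge-transitive if its automorphism group acts transitively on its edges. -/
def IsEdgeTransitive {V : Type*} (G : SimpleGraph V) : Prop :=
  ∀ e ∈ G.edgeSet, ∀ f ∈ G.edgeSet, ∃ σ : G ≃g G, Sym2.map σ e = f

/-! A non-identity automorphism fixing every `u_i` sends some `v_i` to another `v_j` with the same
`u`-neighbours. So `{0, a, b, c}` is invariant under a nonzero translation, hence equals `{0, m, e,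
e + m}` with `m = n/2`.

Closeness is preserved by automorphisms, and `u_i, u_{i+m}` as well as `v_i, v_{i+m}` are close.
Were closeness never to cross between the two sides, no automorphism could take a rim edge to a
spoke (`exists_isClose_of_isEdgeTransitive`). So some `u_i` is close to some `v_j`, which forces `e
= ±2` and `k = ±1` modulo `{0, m}` (`param_of_isClose_inl_inr`). After normalisation `e = 2` and `k`
is `1` or `1 + m`.

Missing pairs never cross sides, so a chain of them cannot join the ends of an edge
(`not_eqvGen_isMissing`). Even `m`, or `k = 1 + m`, would give such a chain. -/

open SimpleGraph

/-! ### Closeness -/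

/-- Two vertices are close if they have at least four common neighbours. -/
def IsClose {V : Type*} (G : SimpleGraph V) (x y : V) : Prop :=
  4 ≤ (G.commonNeighbors x y).encard

theorem IsClose.map {V W : Type*} {G : SimpleGraph V} {H : SimpleGraph W} (σ : G ≃g H) {x y : V}
    (h : IsClose G x y) : IsClose H (σ x) (σ y) := by
  refine le_trans h ?_
  rw [← σ.injective.encard_image]
  apply Set.encard_le_encard
  rintro _ ⟨z, hz, rfl⟩
  rw [mem_commonNeighbors] at hz ⊢
  exact ⟨σ.map_adj_iff.2 hz.1, σ.map_adj_iff.2 hz.2⟩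

theorem isClose_iff {V W : Type*} {G : SimpleGraph V} {H : SimpleGraph W} (σ : G ≃g H) {x y : V} :
    IsClose H (σ x) (σ y) ↔ IsClose G x y :=
  ⟨fun h => by simpa using h.map σ.symm, fun h => h.map σ⟩

theorem not_isClose_of_subset {V : Type*} {G : SimpleGraph V} {x y : V} (p q r : V)
    (h : ∀ z, G.Adj x z → G.Adj y z → z = p ∨ z = q ∨ z = r) : ¬ IsClose G x y := by
  intro hc
  have h1 : G.commonNeighbors x y ⊆ {p, q, r} := by
    intro z hz
    rw [mem_commonNeighbors] at hz
    simpa using h z hz.1 hz.2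
  have h2 := hc.trans (Set.encard_le_encard h1)
  have h3 : ({p, q, r} : Set V).encard ≤ 3 := by
    refine (Set.encard_insert_le _ _).trans ?_
    have h4 : ({q, r} : Set V).encard ≤ 2 :=
      (Set.encard_insert_le _ _).trans (by rw [Set.encard_singleton]; norm_num)
    calc ({q, r} : Set V).encard + 1 ≤ 2 + 1 := by gcongr
      _ = 3 := by norm_num
  exact absurd (h2.trans h3) (by norm_num)

theorem isClose_of_adj {V : Type*} {G : SimpleGraph V} {x y : V} {p q r s : V}
    (hpq : p ≠ q) (hpr : p ≠ r) (hps : p ≠ s) (hqr : q ≠ r) (hqs : q ≠ s) (hrs : r ≠ s)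
    (hx : G.Adj x p ∧ G.Adj x q ∧ G.Adj x r ∧ G.Adj x s)
    (hy : G.Adj y p ∧ G.Adj y q ∧ G.Adj y r ∧ G.Adj y s) : IsClose G x y := by
  have h1 : ({p, q, r, s} : Set V) ⊆ G.commonNeighbors x y := by
    intro z hz
    rw [mem_commonNeighbors]
    simp only [Set.mem_insert_iff, Set.mem_singleton_iff] at hz
    rcases hz with rfl | rfl | rfl | rfl <;> tauto
  refine le_trans (le_of_eq ?_) (Set.encard_le_encard h1)
  rw [Set.encard_insert_of_notMem (by simp [*]), Set.encard_insert_of_notMem (by simp [*]),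
    Set.encard_pair hrs]
  norm_num

/-! ### Closeness in bicirculants -/

/-- A graph on two copies of `R` with circulant parts given by `±r` and `±k`, joined
through the connection set `{0, m, a, a + m}`. -/
structure IsBicirculant {R : Type*} [CommRing R] (G : SimpleGraph (R ⊕ R)) (m a r k : R) :
    Prop where
  adj_inl_inl : ∀ i j, G.Adj (Sum.inl i) (Sum.inl j) ↔ j = i + r ∨ j = i - r
  adj_inr_inr : ∀ i j, G.Adj (Sum.inr i) (Sum.inr j) ↔ j = i + k ∨ j = i - k
  adj_inl_inr : ∀ i j, G.Adj (Sum.inl i) (Sum.inr j) ↔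
    j = i ∨ j = i + m ∨ j = i + a ∨ j = i + a + m

namespace IsBicirculant

variable {R : Type*} [CommRing R] {G : SimpleGraph (R ⊕ R)} {m a r k : R}

theorem adj_inr_inl (hG : IsBicirculant G m a r k) (i j : R) :
    G.Adj (Sum.inr j) (Sum.inl i) ↔ j = i ∨ j = i + m ∨ j = i + a ∨ j = i + a + m := by
  rw [G.adj_comm, hG.adj_inl_inr]

theorem isClose_inl_inl_add (hG : IsBicirculant G m a r k) (hm : m + m = 0) (hm0 : m ≠ 0)
    (ha : a ≠ 0) (ham : a ≠ m) (i : R) : IsClose G (Sum.inl i) (Sum.inl (i + m)) := by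
  apply isClose_of_adj (p := Sum.inr i) (q := Sum.inr (i + m)) (r := Sum.inr (i + a))
    (s := Sum.inr (i + a + m)) <;> simp only [hG.adj_inl_inr, ne_eq, Sum.inr.injEq] <;> grind

theorem isClose_inr_inr_add (hG : IsBicirculant G m a r k) (hm : m + m = 0) (hm0 : m ≠ 0)
    (ha : a ≠ 0) (ham : a ≠ m) (i : R) : IsClose G (Sum.inr i) (Sum.inr (i + m)) := by
  apply isClose_of_adj (p := Sum.inl i) (q := Sum.inl (i + m)) (r := Sum.inl (i - a))
    (s := Sum.inl (i - a + m)) <;> simp only [hG.adj_inr_inl, ne_eq, Sum.inl.injEq] <;> grind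

/-- Outside the listed cases there is at most one common neighbour on the same side, and at most one
coset of `{0, m}` across: three in all. -/
theorem of_isClose_inl_inl (hG : IsBicirculant G m a r k) (hm : m + m = 0)
    (hhalf : ∀ x : R, x + x = 0 → x = 0 ∨ x = m) {i j : R}
    (h : IsClose G (Sum.inl i) (Sum.inl j)) :
    j = i ∨ j = i + m ∨ (j = i + a ∨ j = i + a + m) ∧ (a + a = 0 ∨ a + a = m) := by
  by_contra hcon
  have hr : ∃ t, ∀ l, G.Adj (Sum.inl i) (Sum.inl l) → G.Adj (Sum.inl j) (Sum.inl l) → l = t := by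
    by_cases hj : j = i + r + r
    · refine ⟨i + r, fun l h1 h2 => ?_⟩
      rw [hG.adj_inl_inl] at h1 h2
      have := hhalf (r + r)
      grind
    · refine ⟨i - r, fun l h1 h2 => ?_⟩
      rw [hG.adj_inl_inl] at h1 h2
      grind
  have hs : ∃ s, ∀ l, G.Adj (Sum.inl i) (Sum.inr l) → G.Adj (Sum.inl j) (Sum.inr l) →
      l = s ∨ l = s + m := by
    by_cases hj : j = i + a ∨ j = i + a + m
    · refine ⟨i + a, fun l h1 h2 => ?_⟩
      rw [hG.adj_inl_inr] at h1 h2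
      grind
    · refine ⟨i, fun l h1 h2 => ?_⟩
      rw [hG.adj_inl_inr] at h1 h2
      grind
  obtain ⟨t, ht⟩ := hr
  obtain ⟨s, hs⟩ := hs
  refine not_isClose_of_subset (Sum.inl t) (Sum.inr s) (Sum.inr (s + m)) ?_ h
  rintro (l | l) h1 h2
  · simp [ht l h1 h2]
  · simpa using hs l h1 h2

/-- Exchanging the two circulant parts. -/
theorem comap_swap (hG : IsBicirculant G m a r k) :
    IsBicirculant (G.comap ((Equiv.sumComm R R).trans (Equiv.sumCongr (.neg R) (.neg R))))
      m a k r := by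
  constructor <;> intro i j
  · simp [hG.adj_inr_inr]; grind
  · simp [hG.adj_inl_inl]; grind
  · simp [hG.adj_inr_inl]; grind

theorem of_isClose_inr_inr (hG : IsBicirculant G m a r k) (hm : m + m = 0)
    (hhalf : ∀ x : R, x + x = 0 → x = 0 ∨ x = m) {i j : R}
    (h : IsClose G (Sum.inr i) (Sum.inr j)) :
    j = i ∨ j = i + m ∨ (j = i + a ∨ j = i + a + m) ∧ (a + a = 0 ∨ a + a = m) := by
  have h0 := (isClose_iff (Iso.comap ((Equiv.sumComm R R).trans
    (Equiv.sumCongr (.neg R) (.neg R))) G) (x := Sum.inl (-i)) (y := Sum.inl (-j))).1 (by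
      have hn : ∀ l : R, Iso.comap ((Equiv.sumComm R R).trans
        (Equiv.sumCongr (.neg R) (.neg R))) G (Sum.inl (-l)) = Sum.inr l := fun l => by
          change Sum.inr (- -l) = _
          rw [neg_neg]
      rwa [hn, hn])
  have h1 := hG.comap_swap.of_isClose_inl_inl hm hhalf h0
  grind

/-- Only these four vertices can be common neighbours, so all of them must be. -/
theorem adj_of_isClose_inl_inr (hG : IsBicirculant G m a r k) {i j : R}
    (h : IsClose G (Sum.inl i) (Sum.inr j)) :
    G.Adj (Sum.inl (i + r)) (Sum.inr j) ∧ G.Adj (Sum.inl (i - r)) (Sum.inr j) ∧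
      G.Adj (Sum.inl i) (Sum.inr (j + k)) ∧ G.Adj (Sum.inl i) (Sum.inr (j - k)) := by
  have hz : ∀ z, G.Adj (Sum.inl i) z → G.Adj (Sum.inr j) z →
      z = Sum.inl (i + r) ∨ z = Sum.inl (i - r) ∨ z = Sum.inr (j + k) ∨ z = Sum.inr (j - k) := by
    rintro (l | l) h1 h2
    · rw [hG.adj_inl_inl] at h1
      simpa using h1
    · rw [hG.adj_inr_inr] at h2
      simpa using h2
  refine ⟨?_, ?_, ?_, ?_⟩ <;> by_contra hcon
  · refine not_isClose_of_subset (Sum.inl (i - r)) (Sum.inr (j + k)) (Sum.inr (j - k)) (fun z h1 h2 => ?_) h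
    rcases hz z h1 h2 with rfl | h3
    · exact absurd h2.symm hcon
    · exact h3
  · refine not_isClose_of_subset (Sum.inl (i + r)) (Sum.inr (j + k)) (Sum.inr (j - k)) (fun z h1 h2 => ?_) h
    rcases hz z h1 h2 with h3 | rfl | h3
    · exact .inl h3
    · exact absurd h2.symm hcon
    · exact .inr h3
  · refine not_isClose_of_subset (Sum.inl (i + r)) (Sum.inl (i - r)) (Sum.inr (j - k)) (fun z h1 h2 => ?_) h
    rcases hz z h1 h2 with h3 | h3 | rfl | h3
    · exact .inl h3
    · exact .inr (.inl h3)
    · exact absurd h1 hcon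
    · exact .inr (.inr h3)
  · refine not_isClose_of_subset (Sum.inl (i + r)) (Sum.inl (i - r)) (Sum.inr (j + k)) (fun z h1 h2 => ?_) h
    rcases hz z h1 h2 with h3 | h3 | h3 | rfl
    · exact .inl h3
    · exact .inr (.inl h3)
    · exact .inr (.inr h3)
    · exact absurd h1 hcon

theorem param_of_isClose_inl_inr (hG : IsBicirculant G m a 1 k) (hm : m + m = 0)
    (h2 : (2 : R) ≠ 0) (h2m : (2 : R) ≠ m) {i j : R} (h : IsClose G (Sum.inl i) (Sum.inr j)) :
    (a = 2 ∨ a = 2 + m ∨ a = -2 ∨ a = -2 + m) ∧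
      (k = 1 ∨ k = 1 + m ∨ k = -1 ∨ k = -1 + m) := by
  obtain ⟨h3, h4, h5, -⟩ := hG.adj_of_isClose_inl_inr h
  rw [hG.adj_inl_inr] at h3 h4 h5
  have h6 : (j = i + 1 ∨ j = i + 1 + m) ∧ (j = i - 1 + a ∨ j = i - 1 + a + m) ∨
      -- The two differences `j - (i ± 1)` differ by 2, so they lie in different cosets of `{0, m}`.
      (j = i - 1 ∨ j = i - 1 + m) ∧ (j = i + 1 + a ∨ j = i + 1 + a + m) := by
    clear h5
    grind
  clear h3 h4
  constructor
  · clear h5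
    grind
  · grind

theorem of_isClose_inl_inr (hG : IsBicirculant G m 2 1 k) (hm : m + m = 0)
    (h4 : (4 : R) ≠ 0) (h4m : (4 : R) ≠ m) {i j : R}
    (h : IsClose G (Sum.inl i) (Sum.inr j)) : j = i + 1 ∨ j = i + 1 + m := by
  obtain ⟨h3, h4, -, -⟩ := hG.adj_of_isClose_inl_inr h
  rw [hG.adj_inl_inr] at h3 h4
  grind

end IsBicirculant

/-! ### Edge-transitivity and missing pairs -/

theorem IsEdgeTransitive.exists_map {V : Type*} {G : SimpleGraph V} (h : IsEdgeTransitive G)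
    {x y z w : V} (hxy : G.Adj x y) (hzw : G.Adj z w) :
    ∃ σ : G ≃g G, σ x = z ∧ σ y = w ∨ σ x = w ∧ σ y = z := by
  obtain ⟨σ, hσ⟩ := h s(x, y) hxy s(z, w) hzw
  exact ⟨σ, by simpa using hσ⟩

theorem IsEdgeTransitive.of_iso {V W : Type*} {G : SimpleGraph V} {H : SimpleGraph W}
    (h : IsEdgeTransitive G) (φ : G ≃g H) : IsEdgeTransitive H := by
  rintro ⟨x, y⟩ hxy ⟨z, w⟩ hzw
  obtain ⟨σ, hσ⟩ := h.exists_map (φ.symm.map_adj_iff.2 hxy) (φ.symm.map_adj_iff.2 hzw)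
  refine ⟨(φ.symm.trans σ).trans φ, ?_⟩
  have : ∀ v, ((φ.symm.trans σ).trans φ) v = φ (σ (φ.symm v)) := fun _ => rfl
  simp only [Sym2.map_mk, this]
  rcases hσ with ⟨h1, h2⟩ | ⟨h1, h2⟩ <;> simp [h1, h2, Sym2.eq_swap]

/-- `x` and `y` are not adjacent, but `x` is adjacent to some vertex close to `y`. -/
def IsMissing {V : Type*} (G : SimpleGraph V) (x y : V) : Prop :=
  ¬ G.Adj x y ∧ ∃ z, IsClose G y z ∧ G.Adj x z

theorem IsMissing.eqvGen_map {V : Type*} {G : SimpleGraph V} (σ : G ≃g G) {x y : V}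
    (h : Relation.EqvGen (IsMissing G) x y) :
    Relation.EqvGen (IsMissing G) (σ x) (σ y) := by
  induction h with
  | rel x y h =>
    obtain ⟨h1, z, h2, h3⟩ := h
    exact .rel _ _ ⟨by rwa [σ.map_adj_iff], σ z, h2.map σ, σ.map_adj_iff.2 h3⟩
  | refl x => exact .refl _
  | symm x y _ ih => exact .symm _ _ ih
  | trans x y z _ _ ih1 ih2 => exact .trans _ _ _ ih1 ih2

theorem eqvGen_add_nsmul {V R : Type*} [CommRing R] {r : V → V → Prop} (f : R → V) (d : R)
    (h : ∀ i, r (f i) (f (i + d))) (t : ℕ) (i : R) :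
    Relation.EqvGen r (f i) (f (i + t * d)) := by
  induction t with
  | zero => simpa using Relation.EqvGen.refl (r := r) (f i)
  | succ t ih =>
    refine .trans _ _ _ ih (.rel _ _ ?_)
    convert h (i + t * d) using 2
    push_cast
    ring

namespace IsBicirculant

variable {R : Type*} [CommRing R] {G : SimpleGraph (R ⊕ R)} {m a r k : R}

theorem eq_of_same_param {H : SimpleGraph (R ⊕ R)} (hG : IsBicirculant G m a r k)
    (hH : IsBicirculant H m a r k) : G = H := by
  ext x y
  rcases x with i | i <;> rcases y with j | j
  · rw [hG.adj_inl_inl, hH.adj_inl_inl]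
  · rw [hG.adj_inl_inr, hH.adj_inl_inr]
  · rw [hG.adj_inr_inl, hH.adj_inr_inl]
  · rw [hG.adj_inr_inr, hH.adj_inr_inr]

/-- If no two vertices of different circulant parts are close, then the graph is not
edge-transitive. -/
theorem exists_isClose_of_isEdgeTransitive (hG : IsBicirculant G m a 1 k) (hm : m + m = 0)
    (hm0 : m ≠ 0) (ha : a ≠ 0) (ham : a ≠ m) (h2m : (2 : R) ≠ m)
    (hhalf : ∀ x : R, x + x = 0 → x = 0 ∨ x = m) (h : IsEdgeTransitive G) :
    ∃ i j, IsClose G (Sum.inl i) (Sum.inr j) := by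
  by_contra! hcon
  have hlr : ∀ y, IsClose G (Sum.inr 0) y → G.Adj (Sum.inl 0) y := by
    rintro (l | l) hl
    · exact absurd (by rwa [IsClose, commonNeighbors_symm]) (hcon l 0)
    · rw [hG.adj_inl_inr]
      have := hG.of_isClose_inr_inr hm hhalf hl
      grind
  have hrl : ∀ y, IsClose G (Sum.inl 0) y → G.Adj (Sum.inr 0) y := by
    rintro (l | l) hl
    · rw [hG.adj_inr_inl]
      rcases hG.of_isClose_inl_inl hm hhalf hl with h1 | h1 | ⟨h1, h2 | h2⟩
      · grind
      · grind
      · grind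
      · rcases h1 with rfl | rfl
        · refine .inr (.inr (.inr ?_))
          linear_combination -h2 - hm
        · refine .inr (.inr (.inl ?_))
          linear_combination -h2 - hm
    · exact absurd hl (hcon 0 l)
  -- `u_{1+m}` is close to `u_1` but not adjacent to `u_0`; a spoke admits no such vertex at either
  -- end.
  obtain ⟨σ, hσ⟩ := h.exists_map (x := Sum.inl 0) (y := Sum.inl 1) (z := Sum.inl 0)
    (w := Sum.inr 0) (by simp [hG.adj_inl_inl]) (by simp [hG.adj_inl_inr])
  have h1 := (hG.isClose_inl_inl_add hm hm0 ha ham 1).map σ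
  have h2 : ¬ G.Adj (σ (Sum.inl 0)) (σ (Sum.inl (1 + m))) := by
    rw [σ.map_adj_iff, hG.adj_inl_inl]
    grind
  rcases hσ with ⟨h3, h4⟩ | ⟨h3, h4⟩
  · rw [h4] at h1
    rw [h3] at h2
    exact h2 (hlr _ h1)
  · rw [h4] at h1
    rw [h3] at h2
    exact h2 (hrl _ h1)

theorem isMissing_inl_inl (hG : IsBicirculant G m a 1 k) (hm : m + m = 0)
    (hm0 : m ≠ 0) (ha : a ≠ 0) (ham : a ≠ m) (h2m : (2 : R) ≠ m) (i : R) :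
    IsMissing G (Sum.inl i) (Sum.inl (i + (1 + m))) := by
  refine ⟨?_, _, hG.isClose_inl_inl_add hm hm0 ha ham _, ?_⟩ <;>
  · rw [hG.adj_inl_inl]
    grind

theorem isMissing_inr_inr (hG : IsBicirculant G m a 1 (1 + m)) (hm : m + m = 0)
    (hm0 : m ≠ 0) (ha : a ≠ 0) (ham : a ≠ m) (h2m : (2 : R) ≠ m) (i : R) :
    IsMissing G (Sum.inr i) (Sum.inr (i + 1)) := by
  refine ⟨?_, _, hG.isClose_inr_inr_add hm hm0 ha ham _, ?_⟩ <;>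
  · rw [hG.adj_inr_inr]
    grind

/-- Replacing `y` by a vertex close to it yields no new neighbours on the side opposite `y`. -/
theorem isLeft_eq_of_isMissing (hG : IsBicirculant G m 2 1 k) (hm : m + m = 0) (h4 : (4 : R) ≠ 0) (h4m : (4 : R) ≠ m)
    (hk : k = 1 ∨ k = 1 + m)
    (hhalf : ∀ x : R, x + x = 0 → x = 0 ∨ x = m) {x y : R ⊕ R} (h : IsMissing G x y) :
    x.isLeft = y.isLeft := by
  obtain ⟨h1, z, hz, h3⟩ := h
  rcases x with i | i <;> rcases y with j | j <;> try rfl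
  · exfalso
    rcases z with l | l
    · rw [hG.adj_inl_inr] at h1
      rw [hG.adj_inl_inl] at h3
      have := hG.of_isClose_inl_inr hm h4 h4m (i := l) (j := j)
        (by rwa [IsClose, commonNeighbors_symm])
      grind
    · rw [hG.adj_inl_inr] at h1 h3
      have := hG.of_isClose_inr_inr hm hhalf hz
      grind
  · exfalso
    rcases z with l | l
    · rw [hG.adj_inr_inl] at h1 h3
      have := hG.of_isClose_inl_inl hm hhalf hz
      grind
    · rw [hG.adj_inr_inl] at h1
      rw [hG.adj_inr_inr] at h3
      have := hG.of_isClose_inl_inr hm h4 h4m hz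
      grind

/-- In an edge-transitive graph with these parameters no edge joins vertices linked by a chain of
missing pairs. -/
theorem not_eqvGen_isMissing (hG : IsBicirculant G m 2 1 k) (hm : m + m = 0) (h4 : (4 : R) ≠ 0) (h4m : (4 : R) ≠ m)
    (hk : k = 1 ∨ k = 1 + m)
    (hhalf : ∀ x : R, x + x = 0 → x = 0 ∨ x = m) (h : IsEdgeTransitive G) {x y : R ⊕ R}
    (hxy : G.Adj x y) : ¬ Relation.EqvGen (IsMissing G) x y := by
  intro hE
  have hleft : ∀ u v, Relation.EqvGen (IsMissing G) u v → u.isLeft = v.isLeft := by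
    intro u v huv
    induction huv with
    | rel u v h => exact hG.isLeft_eq_of_isMissing hm h4 h4m hk hhalf h
    | refl u => rfl
    | symm u v _ ih => exact ih.symm
    | trans u v w _ _ ih1 ih2 => exact ih1.trans ih2
  obtain ⟨σ, hσ⟩ := h.exists_map hxy (z := Sum.inl 0) (w := Sum.inr 0)
    (by simp [hG.adj_inl_inr])
  have := hleft _ _ (IsMissing.eqvGen_map σ hE)
  rcases hσ with ⟨h5, h6⟩ | ⟨h5, h6⟩ <;> simp [h5, h6] at this

end IsBicirculant

/-! ### Translation-invariant connection sets -/

theorem exists_involution_of_translation_invariant {R : Type*} [CommRing R] {a b c d : R}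
    (ha : a ≠ 0) (hb : b ≠ 0) (hc : c ≠ 0) (hab : a ≠ b) (hac : a ≠ c) (hbc : b ≠ c)
    (hd : d ≠ 0)
    (h : ∀ x, x = 0 ∨ x = a ∨ x = b ∨ x = c → x + d = 0 ∨ x + d = a ∨ x + d = b ∨ x + d = c) :
    ∃ m e : R, m ≠ 0 ∧ m + m = 0 ∧ e ≠ 0 ∧ e ≠ m ∧
      ∀ x, x = 0 ∨ x = a ∨ x = b ∨ x = c ↔ x = 0 ∨ x = m ∨ x = e ∨ x = e + m := by
  have key : ∀ a b c : R, a ≠ 0 → b ≠ 0 → c ≠ 0 → a ≠ b → a ≠ c → b ≠ c →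
      (∀ x, x = 0 ∨ x = a ∨ x = b ∨ x = c → x + a = 0 ∨ x + a = a ∨ x + a = b ∨ x + a = c) →
      ∃ m e : R, m ≠ 0 ∧ m + m = 0 ∧ e ≠ 0 ∧ e ≠ m ∧
        ∀ x, x = 0 ∨ x = a ∨ x = b ∨ x = c ↔ x = 0 ∨ x = m ∨ x = e ∨ x = e + m := by
    intro a b c ha hb hc hab hac hbc h
    have h1 := h a (by simp)
    have h2 := h b (by simp)
    have h3 := h c (by simp)
    clear h
    -- The translation has order 2, or order 4 with its double as the involution.
    have h4 : a + a = 0 ∧ c = b + a ∨ a + a = b ∧ b + b = 0 ∧ c = a + b ∨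
        a + a = c ∧ c + c = 0 ∧ b = a + c := by
      rcases h1 with h1 | h1 | h1 | h1
      · clear h3
        grind
      · grind
      · have h4 : c + a = 0 := by
          clear h2
          grind
        clear h3
        grind
      · have h4 : b + a = 0 := by
          clear h3
          grind
        clear h2
        grind
    rcases h4 with ⟨h5, h6⟩ | ⟨h5, h6, h7⟩ | ⟨h5, h6, h7⟩
    · exact ⟨a, b, ha, h5, hb, hab.symm, fun x => by rw [h6]⟩
    · exact ⟨b, a, hb, h6, ha, hab, fun x => by rw [h7, or_left_comm (a := x = a)]⟩
    · exact ⟨c, a, hc, h6, ha, hac, fun x => by rw [h7, or_rotate (a := x = c)]⟩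
  have h0 := h 0 (by simp)
  rw [zero_add] at h0
  rcases h0 with h0 | rfl | rfl | rfl
  · exact absurd h0 hd
  · exact key _ _ _ ha hb hc hab hac hbc h
  · obtain ⟨m, e, h1, h2, h3, h4, h5⟩ := key d a c hb ha hc hab.symm hbc hac
      (fun x hx => by
        rw [or_left_comm (a := x + d = d)]
        exact h x (by rwa [or_left_comm (a := x = a)]))
    exact ⟨m, e, h1, h2, h3, h4, fun x => by rw [← h5, or_left_comm (a := x = a)]⟩
  · obtain ⟨m, e, h1, h2, h3, h4, h5⟩ := key d a b hc ha hb hac.symm hbc.symm hab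
      (fun x hx => by
        rw [or_rotate (a := x + d = d)]
        exact h x (by rwa [or_rotate (a := x = d)] at hx))
    exact ⟨m, e, h1, h2, h3, h4, fun x => by rw [← h5, or_rotate (a := x = d)]⟩

theorem nestGraph_adj_inl_inl {n : ℕ} (hn : 2 ≤ n) (a b c k i j : ZMod n) :
    (nestGraph n a b c k).Adj (Sum.inl i) (Sum.inl j) ↔ j = i + 1 ∨ j = i - 1 := by
  have : Fact (1 < n) := ⟨hn⟩
  have h1 : (1 : ZMod n) ≠ 0 := one_ne_zero
  simp only [nestGraph, fromRel_adj, nestRel, ne_eq, Sum.inl.injEq]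
  grind

theorem nestGraph_adj_inr_inr {n : ℕ} {k : ZMod n} (hk : k ≠ 0) (a b c i j : ZMod n) :
    (nestGraph n a b c k).Adj (Sum.inr i) (Sum.inr j) ↔ j = i + k ∨ j = i - k := by
  simp only [nestGraph, fromRel_adj, nestRel, ne_eq, Sum.inr.injEq]
  grind

theorem nestGraph_adj_inl_inr {n : ℕ} (a b c k i j : ZMod n) :
    (nestGraph n a b c k).Adj (Sum.inl i) (Sum.inr j) ↔
      j - i = 0 ∨ j - i = a ∨ j - i = b ∨ j - i = c := by
  simp only [nestGraph, fromRel_adj, nestRel, ne_eq, reduceCtorEq, not_false_eq_true, true_and,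
    or_false]
  grind

/-! ### Arithmetic modulo `2m` and parity -/

theorem ZMod.natCast_ne_natCast_of_lt {n x y : ℕ} (hx : x < n) (hy : y < n) (h : x ≠ y) :
    (x : ZMod n) ≠ y := by
  rw [ne_eq, ZMod.natCast_eq_natCast_iff', Nat.mod_eq_of_lt hx, Nat.mod_eq_of_lt hy]
  exact h

theorem ZMod.natCast_half_add_self (m : ℕ) : (m : ZMod (2 * m)) + m = 0 := by
  have := ZMod.natCast_self (2 * m)
  push_cast at this
  rw [← this]
  ring

theorem ZMod.eq_zero_or_eq_half_of_add_self {m : ℕ} (hm : m ≠ 0) (x : ZMod (2 * m))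
    (h : x + x = 0) : x = 0 ∨ x = m := by
  have : NeZero (2 * m) := ⟨by omega⟩
  obtain ⟨t, ht, rfl⟩ : ∃ t : ℕ, t < 2 * m ∧ (t : ZMod (2 * m)) = x :=
    ⟨x.val, x.val_lt, by simp⟩
  have h1 : ((t + t : ℕ) : ZMod (2 * m)) = 0 := by exact_mod_cast h
  rw [ZMod.natCast_eq_zero_iff] at h1
  obtain ⟨q, hq⟩ := h1
  have hq2 : q < 2 := by nlinarith
  interval_cases q
  · left
    have : t = 0 := by omega
    simp [this]
  · right
    have : t = m := by omega
    rw [this]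

theorem ZMod.exists_half_of_add_self {n : ℕ} [NeZero n] {x : ZMod n} (hx : x ≠ 0) (h : x + x = 0) :
    ∃ m : ℕ, n = 2 * m ∧ x = m := by
  refine ⟨x.val, ?_, by simp⟩
  have h1 : ((x.val + x.val : ℕ) : ZMod n) = 0 := by simpa using h
  rw [ZMod.natCast_eq_zero_iff] at h1
  obtain ⟨q, hq⟩ := h1
  have h2 := x.val_lt
  have h3 : x.val ≠ 0 := by simpa using hx
  have hq2 : q < 2 := by
    by_contra!
    have := Nat.mul_le_mul_left n this
    omega
  interval_cases q <;> omega

/-- The arithmetic facts about `m` in `ℤ/2mℤ` that the classification uses. -/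
theorem ZMod.half_facts {m : ℕ} (hm : 5 ≤ m) :
    (m : ZMod (2 * m)) ≠ 0 ∧ (2 : ZMod (2 * m)) ≠ 0 ∧ (2 : ZMod (2 * m)) ≠ m ∧
      (4 : ZMod (2 * m)) ≠ 0 ∧ (4 : ZMod (2 * m)) ≠ m ∧ (1 : ZMod (2 * m)) ≠ 0 ∧
      (1 : ZMod (2 * m)) ≠ m := by
  have h : ∀ x y : ℕ, x < 2 * m → y < 2 * m → x ≠ y → (x : ZMod (2 * m)) ≠ y :=
    fun x y => ZMod.natCast_ne_natCast_of_lt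
  refine ⟨by simpa using h m 0 (by omega) (by omega) (by omega),
    by simpa using h 2 0 (by omega) (by omega) (by omega),
    by simpa using h 2 m (by omega) (by omega) (by omega),
    by simpa using h 4 0 (by omega) (by omega) (by omega),
    by simpa using h 4 m (by omega) (by omega) (by omega),
    by simpa using h 1 0 (by omega) (by omega) (by omega),
    by simpa using h 1 m (by omega) (by omega) (by omega)⟩

theorem IsBicirculant.odd_and_eq_one {m : ℕ} (hm5 : 5 ≤ m) {k : ZMod (2 * m)}
    {G : SimpleGraph (ZMod (2 * m) ⊕ ZMod (2 * m))} (hG : IsBicirculant G (m : ZMod (2 * m)) 2 1 k)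
    (hk : k = 1 ∨ k = 1 + (m : ZMod (2 * m))) (h : IsEdgeTransitive G) : Odd m ∧ k = 1 := by
  have hm := ZMod.natCast_half_add_self m
  have hhalf := ZMod.eq_zero_or_eq_half_of_add_self (m := m) (by omega)
  obtain ⟨hm0, h2, h2m, h4, h4m, -, -⟩ := ZMod.half_facts hm5
  have hodd : Odd m := by
    by_contra hm2
    rw [Nat.not_odd_iff_even] at hm2
    obtain ⟨q, hq⟩ := hm2
    have hmm : (m : ZMod (2 * m)) * m = 0 := by
      have h5 : (m : ZMod (2 * m)) = q + q := by exact_mod_cast congrArg (Nat.cast) hq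
      calc (m : ZMod (2 * m)) * m = m * (q + q) := by rw [← h5]
        _ = (m + m) * q := by ring
        _ = 0 := by rw [hm, zero_mul]
    refine hG.not_eqvGen_isMissing hm h4 h4m hk hhalf h (x := Sum.inl 0) (y := Sum.inl 1)
      (by simp [hG.adj_inl_inl]) ?_
    -- For even `m`, `m * m = 0`, so `m + 1` steps of `1 + m` add up to 1.
    convert eqvGen_add_nsmul Sum.inl (1 + (m : ZMod (2 * m)))
      (hG.isMissing_inl_inl hm hm0 h2 h2m h2m) (m + 1) 0 using 2
    push_cast
    linear_combination -hmm - hm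
  refine ⟨hodd, hk.resolve_right ?_⟩
  rintro rfl
  refine hG.not_eqvGen_isMissing hm h4 h4m hk hhalf h (x := Sum.inr 0)
    (y := Sum.inr (1 + (m : ZMod (2 * m)))) (by simp [hG.adj_inr_inr]) ?_
  convert eqvGen_add_nsmul Sum.inr (1 : ZMod (2 * m))
    (hG.isMissing_inr_inr hm hm0 h2 h2m h2m) (m + 1) 0 using 2
  push_cast
  ring

theorem isNestParam_two_half {m : ℕ} (hm5 : 5 ≤ m) :
    IsNestParam (2 * m) 2 (m : ZMod (2 * m)) (2 + (m : ZMod (2 * m))) 1 := by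
  have hm := ZMod.natCast_half_add_self m
  obtain ⟨hm0, h2, h2m, h4, h4m, h1, h1m⟩ := ZMod.half_facts hm5
  refine ⟨by omega, h2, hm0, ?_, h1, h2m, ?_, ?_, fun _ => ?_⟩
  · grind
  · grind
  · grind
  · rwa [Nat.mul_div_cancel_left m two_pos]

theorem isBicirculant_nestGraph {n : ℕ} (hn : 2 ≤ n) {a b c k m e : ZMod n} (hk : k ≠ 0)
    (hS : ∀ x, x = 0 ∨ x = a ∨ x = b ∨ x = c ↔ x = 0 ∨ x = m ∨ x = e ∨ x = e + m) :
    IsBicirculant (nestGraph n a b c k) m e 1 k where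
  adj_inl_inl := nestGraph_adj_inl_inl hn a b c k
  adj_inr_inr := nestGraph_adj_inr_inr hk a b c
  adj_inl_inr i j := by
    rw [nestGraph_adj_inl_inr, hS]
    simp only [sub_eq_iff_eq_add', add_zero, add_assoc]

/-- A non-identity automorphism fixing all `u_i` forces the connection set to be a union of two
cosets of a subgroup of order two. -/
theorem exists_involution_of_fix_inl {n : ℕ} {a b c k : ZMod n} (hparam : IsNestParam n a b c k)
    (σ : nestGraph n a b c k ≃g nestGraph n a b c k) (hne : ∃ x, σ x ≠ x)
    (hσ : ∀ i, σ (Sum.inl i) = Sum.inl i) :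
    ∃ m e : ZMod n, m ≠ 0 ∧ m + m = 0 ∧ e ≠ 0 ∧ e ≠ m ∧
      ∀ x, x = 0 ∨ x = a ∨ x = b ∨ x = c ↔ x = 0 ∨ x = m ∨ x = e ∨ x = e + m := by
  obtain ⟨i, hi⟩ : ∃ i, σ (Sum.inr i) ≠ Sum.inr i := by
    obtain ⟨i | i, hi⟩ := hne
    · exact absurd (hσ i) hi
    · exact ⟨i, hi⟩
  obtain ⟨j, hj⟩ : ∃ j, σ (Sum.inr i) = Sum.inr j := by
    rcases h : σ (Sum.inr i) with j | j
    · rw [← hσ j] at h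
      exact absurd (σ.injective h) (by simp)
    · exact ⟨j, rfl⟩
  rw [hj, ne_eq, Sum.inr.injEq] at hi
  refine exists_involution_of_translation_invariant hparam.a_ne_zero hparam.b_ne_zero
    hparam.c_ne_zero hparam.a_ne_b hparam.a_ne_c hparam.b_ne_c (sub_ne_zero.2 hi) fun x hx => ?_
  have h1 := σ.map_adj_iff (v := Sum.inl (i - x)) (w := Sum.inr i)
  rw [hj, hσ, nestGraph_adj_inl_inr, nestGraph_adj_inl_inr] at h1
  have h2 := h1.2 (by rwa [sub_sub_cancel])
  rwa [show j - (i - x) = x + (j - i) by ring] at h2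

/-! ### Normalising the parameters -/

namespace IsBicirculant

variable {R : Type*} [CommRing R] {G : SimpleGraph (R ⊕ R)} {m a r k : R}

theorem of_param_add (hG : IsBicirculant G m (a + m) r k) (hm : m + m = 0) :
    IsBicirculant G m a r k where
  adj_inl_inl := hG.adj_inl_inl
  adj_inr_inr := hG.adj_inr_inr
  adj_inl_inr i j := by
    rw [hG.adj_inl_inr, show i + (a + m) + m = i + a by linear_combination hm, ← add_assoc,
      or_comm (a := j = i + a + m)]

theorem of_neg_hub (hG : IsBicirculant G m a r (-k)) : IsBicirculant G m a r k where
  adj_inl_inl := hG.adj_inl_inl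
  adj_inr_inr i j := by
    rw [hG.adj_inr_inr, sub_neg_eq_add, or_comm, sub_eq_add_neg]
  adj_inl_inr := hG.adj_inl_inr

/-- Shifting the second circulant part. -/
theorem comap_shift (hG : IsBicirculant G m (-a) r k) :
    IsBicirculant (G.comap (Equiv.sumCongr (.refl R) (Equiv.subRight a))) m a r k := by
  constructor <;> intro i j
  · simp [hG.adj_inl_inl]
  · simp [hG.adj_inr_inr]; grind
  · simp [hG.adj_inl_inr]; grind

/-- Normalisation of the spoke parameter. -/
theorem exists_iso_of_param (hG : IsBicirculant G m a r k) (hm : m + m = 0) {b : R}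
    (ha : a = b ∨ a = b + m ∨ a = -b ∨ a = -b + m) :
    ∃ H : SimpleGraph (R ⊕ R), IsBicirculant H m b r k ∧ Nonempty (G ≃g H) := by
  rcases ha with rfl | rfl | rfl | rfl
  · exact ⟨G, hG, ⟨.refl⟩⟩
  · exact ⟨G, hG.of_param_add hm, ⟨.refl⟩⟩
  · exact ⟨_, hG.comap_shift, ⟨(Iso.comap _ G).symm⟩⟩
  · exact ⟨_, (hG.of_param_add hm).comap_shift, ⟨(Iso.comap _ G).symm⟩⟩

/-- Normalisation of the hub parameter. -/
theorem exists_hub_param (hG : IsBicirculant G m a r k) (hm : m + m = 0) {l : R}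
    (hk : k = l ∨ k = l + m ∨ k = -l ∨ k = -l + m) :
    ∃ k', (k' = l ∨ k' = l + m) ∧ IsBicirculant G m a r k' := by
  rcases hk with rfl | rfl | rfl | rfl
  · exact ⟨_, .inl rfl, hG⟩
  · exact ⟨_, .inr rfl, hG⟩
  · exact ⟨_, .inl rfl, hG.of_neg_hub⟩
  · refine ⟨_, .inr rfl, of_neg_hub ?_⟩
    rwa [show -(l + m) = -l + m by linear_combination -hm]

end IsBicirculant

theorem mainTheorem2 (n : ℕ) (a b c k : ZMod n) (hparam : IsNestParam n a b c k)
    (hn : 8 < n) (hedge : IsEdgeTransitive (nestGraph n a b c k))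
    (hfix : ∃ σ : nestGraph n a b c k ≃g nestGraph n a b c k,
      (∃ x, σ x ≠ x) ∧ ∀ i : ZMod n, σ (Sum.inl i) = Sum.inl i) :
    ∃ m : ℕ, Odd m ∧ IsNestParam (2 * m) 2 (m : ZMod (2 * m)) (2 + (m : ZMod (2 * m))) 1 ∧
      Nonempty (nestGraph n a b c k ≃g
        nestGraph (2 * m) 2 (m : ZMod (2 * m)) (2 + (m : ZMod (2 * m))) 1) := by
  obtain ⟨σ, hne, hσ⟩ := hfix
  obtain ⟨M, e, hM0, hM, he, heM, hS⟩ := exists_involution_of_fix_inl hparam σ hne hσ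
  have : NeZero n := ⟨by omega⟩
  obtain ⟨m, rfl, rfl⟩ := ZMod.exists_half_of_add_self hM0 hM
  -- This is where `n > 8` enters: it excludes `4 = m`.
  have hm5 : 5 ≤ m := by omega
  have hG := isBicirculant_nestGraph (by omega) hparam.k_ne_zero hS
  have hhalf := ZMod.eq_zero_or_eq_half_of_add_self (m := m) (by omega)
  obtain ⟨-, h2, h2m, -, -, h1, -⟩ := ZMod.half_facts hm5
  obtain ⟨i, j, hij⟩ := hG.exists_isClose_of_isEdgeTransitive hM hM0 he heM h2m hhalf hedge
  obtain ⟨hpe, hpk⟩ := hG.param_of_isClose_inl_inr hM h2 h2m hij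
  obtain ⟨H, hH, ⟨φ⟩⟩ := hG.exists_iso_of_param hM hpe
  obtain ⟨k', hk', hH'⟩ := hH.exists_hub_param hM hpk
  obtain ⟨hodd, rfl⟩ := hH'.odd_and_eq_one hm5 hk' (hedge.of_iso φ)
  refine ⟨m, hodd, isNestParam_two_half hm5, ?_⟩
  have hT : IsBicirculant (nestGraph (2 * m) 2 (m : ZMod (2 * m)) (2 + (m : ZMod (2 * m))) 1)
      (m : ZMod (2 * m)) 2 1 1 :=
    isBicirculant_nestGraph (by omega) h1 fun x => by rw [or_left_comm (a := x = 2)]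
  rw [← hH'.eq_of_same_param hT]
  exact ⟨φ⟩
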